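/- Let $n\ge 1$, let $c_0,\dots,c_{n-1}$ be real numbers, and let $$f(\lambda)=\lambda_1\cdots\lambda_n-\sum_{k=0}^{n-1}c_k\,\sigma_k(\lambda),\qquad \lambda\in\mathbb{R}^n,$$ where $\sigma_k$ is the $k$-th elementary symmetric polynomial ($\sigma_0=1$). Let $$r_f(x)=f(x,\dots,x)=x^n-\sum_{k=0}^{n-1}c_k\binom{n}{k}x^k$$ be its diagonal restriction, and let $\Gamma_n=\{\lambda\in\mathbb{R}^n:\lambda_i>0 \text{ for all } i\}$. A connected component $\Gamma$ of $\{f>0\}\subset\mathbb{R}^n$ is called $\Upsilon$-stable if $\Gamma\subseteq q+\Gamma_n$ for some $q\in\mathbb{R}^n$. Its $\Upsilon_1$-cone is the set of all $\mu\in\mathbb{R}^n$ such that, for every permutation $s$ of $\{1,\dots,n\}$, the point $(\mu_{s(1)},\dots,\mu_{s(n-1)})$ lies in the projection of $\Gamma$ to $\mathbb{R}^{n-1}$ that drops the last entry (for $n=1$ this is all of $\mathbb{R}$). The component $\Gamma$ is called strictly $\Upsilon$-stable if it is $\Upsilon$-stable and its boundary $\partial\Gamma$ is contained in its $\Upsilon_1$-cone.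 A real polynomial $p$ of degree $n$ is called right-Noetherian if for every $k\in\{0,\dots,n-1\}$ the derivative $p^{(k)}$ has a real root which is greater than or equal to every real root of $p^{(k+1)}$. It is called strictly right-Noetherian if, in addition, $p$ has a real root which is strictly greater than every real root of $p'$. Then $\{f>0\}$ has a connected component which is $\Upsilon$-stable if and only if $r_f$ is right-Noetherian. Moreover, an $\Upsilon$-stable connected component of $\{f>0\}$ is strictly $\Upsilon$-stable if and only if $r_f$ is strictly right-Noetherian. -/

import Mathlib

namespace InverseSigma

/-- The general inverse `σ_k` type multilinear polynomial
`λ_1 ⋯ λ_n - ∑_{k=0}^{n-1} c_k σ_k(λ)` in `n` variables, with real coefficients `c_0, …, c_{n-1}`. -/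
noncomputable def poly (n : ℕ) (c : Fin n → ℝ) : MvPolynomial (Fin n) ℝ :=
  ∏ i, MvPolynomial.X i
    - ∑ k : Fin n, MvPolynomial.C (c k) * MvPolynomial.esymm (Fin n) ℝ (k : ℕ)

/-- The diagonal restriction `r_f(x) = f(x, …, x)`, as a univariate polynomial. -/
noncomputable def diagRestriction {n : ℕ} (f : MvPolynomial (Fin n) ℝ) : Polynomial ℝ :=
  MvPolynomial.aeval (fun _ => Polynomial.X) f

/-- `r_f(x) = x^n - ∑_{k=0}^{n-1} c_k (n choose k) x^k`. -/
theorem diagRestriction_poly (n : ℕ) (c : Fin n → ℝ) :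
    diagRestriction (poly n c) = Polynomial.X ^ n
      - ∑ k : Fin n, Polynomial.C (c k * (n.choose k : ℝ)) * Polynomial.X ^ (k : ℕ) := by
  unfold diagRestriction poly
  simp only [map_sub, map_prod, map_sum, map_mul, MvPolynomial.aeval_X, Finset.prod_const,
    Finset.card_univ, Fintype.card_fin, MvPolynomial.algHom_C, MvPolynomial.aeval_esymm_eq_multiset_esymm]
  congr 1
  refine Finset.sum_congr rfl fun k _ => ?_
  rw [Finset.esymm_map_val]
  rw [Finset.sum_congr rfl (g := fun _ => (Polynomial.X : Polynomial ℝ) ^ (k : ℕ))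
    (fun s hs => by rw [Finset.prod_const, (Finset.mem_powersetCard.1 hs).2])]
  simp [Finset.sum_const, Finset.card_powersetCard, mul_assoc]

/-- The open set `{f > 0}` in `ℝ^n`. -/
def posSet {n : ℕ} (f : MvPolynomial (Fin n) ℝ) : Set (Fin n → ℝ) :=
  {x | 0 < MvPolynomial.eval x f}

/-- `G` is a connected component of the set `S` (in particular, `G` is nonempty). -/
def IsConnComponent {X : Type*} [TopologicalSpace X] (S G : Set X) : Prop :=
  ∃ x ∈ S, G = connectedComponentIn S x

/-- The (open) positive orthant `Γ_n` of `ℝ^n`. -/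
def positiveOrthant (n : ℕ) : Set (Fin n → ℝ) :=
  {x | ∀ i, 0 < x i}

/-- `G` is contained in a translate `q + Γ_n` of the positive orthant. -/
def UpsilonStable {n : ℕ} (G : Set (Fin n → ℝ)) : Prop :=
  ∃ q : Fin n → ℝ, G ⊆ (fun x => q + x) '' positiveOrthant n

/-- The projection `ℝ^n → ℝ^{n-k}` that drops the last `k` entries. -/
def dropLast {n : ℕ} (k : ℕ) (x : Fin n → ℝ) : Fin (n - k) → ℝ :=
  fun i => x (Fin.castLE (Nat.sub_le n k) i)

/-- The `Υ_k`-cone of `G`: all `μ` such that `(μ_{s(1)}, …, μ_{s(n-k)})` lies in the projection of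
`G` to `ℝ^{n-k}` for every permutation `s`. -/
def upsilonCone {n : ℕ} (k : ℕ) (G : Set (Fin n → ℝ)) : Set (Fin n → ℝ) :=
  {μ | ∀ s : Equiv.Perm (Fin n), dropLast k (fun i => μ (s i)) ∈ dropLast k '' G}

/-- `G` is `Υ`-stable and its boundary lies in the `Υ_1`-cone of `G`. -/
def StrictlyUpsilonStable {n : ℕ} (G : Set (Fin n → ℝ)) : Prop :=
  UpsilonStable G ∧ frontier G ⊆ upsilonCone 1 G

/-- For each `k < deg p`, some real root of `p^{(k)}` is at least as large as every real root of
`p^{(k+1)}` (no condition if `p^{(k+1)}` is a nonzero constant, i.e. `k = deg p - 1`). -/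
def RightNoetherian (p : Polynomial ℝ) : Prop :=
  ∀ k < p.natDegree, ∃ x : ℝ, (Polynomial.derivative^[k] p).IsRoot x ∧
    ∀ y : ℝ, (Polynomial.derivative^[k + 1] p).IsRoot y → y ≤ x

/-- `p` is right-Noetherian and some (equivalently, the largest) real root of `p` is strictly
greater than every real root of `p'`. -/
def StrictlyRightNoetherian (p : Polynomial ℝ) : Prop :=
  RightNoetherian p ∧
    ∃ x : ℝ, p.IsRoot x ∧ ∀ y : ℝ, (Polynomial.derivative p).IsRoot y → y < x

end InverseSigma

/-!
Index the coefficients of `f` by codegree, so that all partial derivatives of `f` come from the same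
coefficient sequence and their diagonal restrictions are, up to constants, the derivatives of `r_f`.

Let `P` be the region where `f` and all its partial derivatives are positive; it is an upper set,
hence connected, and its closure is the region where they are all nonnegative. In a `Υ`-stable
component no coordinate can be lowered indefinitely, which forces the first partial derivatives to
be positive; the component is then closed under raising coordinates, which forces the remaining ones
to be nonnegative. So the only candidate for a `Υ`-stable component is `P`, and `P` is one exactly
if the other derivatives stay positive on `closure P` where `f > 0` (stability).

Stability passes to the partial derivatives, and on the diagonal it gives right-Noetherianity: the
infimum of the diagonal part of `P` is a root of `r_f` beyond which all derivatives are positive.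
For the converse, induct on the number of variables: let `g = ∂f/∂x_i` be stable and vanish at a
boundary point `x` of its region. Moving two coordinates towards each other along a level set of
`g`, which in these coordinates is a hyperbola, lowers their sum and, by a discriminant inequality
that stability implies, does not decrease the part of `f` independent of `x_i`. Minimising the sum
of the coordinates, `f(x)` is at most `r_f(z)` for the boundary root `z` of the diagonal restriction
of `g`. If `r_f` has a root at or beyond all roots of its derivative, then `r_f(z) ≤ 0`, so
`f(x) > 0` is impossible; if the root lies strictly beyond, then `r_f(z) < 0`, so `f(x) = 0` is
impossible too. The latter is strict stability, because the `Υ_1`-cone of `P` is the region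
where all proper partial derivatives of `f` are positive.
-/

namespace InverseSigma

open Finset Filter Topology Polynomial

section Blossom

variable {R ι κ : Type*} [CommSemiring R]

/-- The symmetric multi-affine polynomial `∑_{T ⊆ U} b_{|U| - |T|} ∏_{i ∈ T} x_i` in the variables
indexed by `U`, with coefficients `b` indexed by codegree. With this indexing its partial
derivatives are the polynomials `blossom b T` for `T ⊆ U`. -/
def blossom (b : ℕ → R) (U : Finset ι) (x : ι → R) : R :=
  ∑ T ∈ U.powerset, b (#U - #T) * ∏ i ∈ T, x i

/-- The diagonal restriction of `blossom b U` for `|U| = m`, as a univariate polynomial. For fixed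
`b` these form an Appell sequence: the derivative of the `m + 1`-st is `m + 1` times the `m`-th. -/
noncomputable def appell (b : ℕ → R) (m : ℕ) : R[X] :=
  ∑ k ∈ range (m + 1), C ((m.choose k : R) * b (m - k)) * X ^ k

theorem blossom_const (b : ℕ → R) (U : Finset ι) (x : R) :
    blossom b U (fun _ => x) = (appell b #U).eval x := by
  simp only [blossom, prod_const]
  rw [sum_powerset_apply_card fun k => b (#U - k) * x ^ k]
  simp [appell, eval_finsetSum, mul_assoc]

theorem blossom_congr (b : ℕ → R) {U : Finset ι} {x y : ι → R} (h : ∀ i ∈ U, x i = y i) :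
    blossom b U x = blossom b U y :=
  sum_congr rfl fun _ hT => by rw [prod_congr rfl fun i hi => h i (mem_powerset.1 hT hi)]

@[simp]
theorem blossom_empty (b : ℕ → R) (x : ι → R) : blossom b ∅ x = b 0 := by
  simp [blossom]

section DecidableEq

variable [DecidableEq ι]

theorem blossom_insert (b : ℕ → R) {U : Finset ι} {i : ι} (hi : i ∉ U) (x : ι → R) :
    blossom b (insert i U) x = x i * blossom b U x + blossom (b ∘ Nat.succ) U x := by
  unfold blossom
  rw [sum_powerset_insert hi, add_comm, mul_sum, card_insert_of_notMem hi]
  congr 1 <;> refine sum_congr rfl fun T hT => ?_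
  · have hiT : i ∉ T := fun h => hi (mem_powerset.1 hT h)
    rw [prod_insert hiT, card_insert_of_notMem hiT, Nat.add_sub_add_right]
    ring
  · rw [Nat.sub_add_comm (card_le_card (mem_powerset.1 hT))]
    rfl

theorem blossom_update_of_notMem (b : ℕ → R) {U : Finset ι} {i : ι} (hi : i ∉ U) (x : ι → R)
    (t : R) : blossom b U (Function.update x i t) = blossom b U x :=
  blossom_congr b fun _ hj => Function.update_of_ne (ne_of_mem_of_not_mem hj hi) _ _

theorem blossom_insert_update (b : ℕ → R) {U : Finset ι} {i : ι} (hi : i ∉ U) (x : ι → R)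
    (t : R) : blossom b (insert i U) (Function.update x i t)
      = t * blossom b U x + blossom (b ∘ Nat.succ) U x := by
  simp only [blossom_insert b hi, blossom_update_of_notMem _ hi, Function.update_self]

theorem blossom_insert_insert (b : ℕ → R) {W : Finset ι} {j l : ι} (hjl : j ≠ l) (hj : j ∉ W)
    (hl : l ∉ W) (x : ι → R) :
    blossom b (insert j (insert l W)) x = x j * x l * blossom b W x
      + (x j + x l) * blossom (b ∘ Nat.succ) W x + blossom ((b ∘ Nat.succ) ∘ Nat.succ) W x := by
  rw [blossom_insert b (by simp [hjl, hj]), blossom_insert b hl, blossom_insert _ hl]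
  ring

theorem blossom_add (b : ℕ → R) (U : Finset ι) (x v : ι → R) :
    blossom b U (x + v) = ∑ T ∈ U.powerset, blossom b T x * ∏ i ∈ U \ T, v i := by
  induction U using Finset.induction_on generalizing b with
  | empty => simp
  | insert i U hi ih =>
    rw [blossom_insert b hi, ih, ih, sum_powerset_insert hi, Pi.add_apply, add_mul, mul_sum,
      mul_sum, add_right_comm, ← sum_add_distrib, add_comm]
    congr 1 <;> refine sum_congr rfl fun T hT => ?_ <;>
      have hiT : i ∉ T := fun h => hi (mem_powerset.1 hT h)
    · rw [insert_sdiff_of_notMem _ hiT, prod_insert (by simp [hi])]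
      ring
    · rw [blossom_insert b hiT, insert_sdiff_insert, sdiff_insert_of_notMem hi]
      ring

end DecidableEq

theorem blossom_map (b : ℕ → R) (e : κ ↪ ι) (U : Finset κ) (x : ι → R) :
    blossom b (U.map e) x = blossom b U (x ∘ e) := by
  classical
  induction U using Finset.induction_on generalizing b with
  | empty => simp
  | insert i U hi ih =>
    rw [map_insert, blossom_insert b (by simpa using hi), blossom_insert b hi, ih, ih,
      Function.comp_apply]

end Blossom

theorem blossom_update {R ι : Type*} [CommRing R] [DecidableEq ι] (b : ℕ → R) {U : Finset ι}
    {i : ι} (hi : i ∈ U) (x : ι → R) (t : R) :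
    blossom b U (Function.update x i t) = blossom b U x + (t - x i) * blossom b (U.erase i) x := by
  conv_lhs => rw [← insert_erase hi, blossom_insert_update b (notMem_erase i U)]
  conv_rhs => rw [← insert_erase hi, blossom_insert b (notMem_erase i U), erase_insert_eq_erase,
    erase_idem]
  ring

section Appell

variable {R : Type*} [CommSemiring R]

@[simp]
theorem appell_zero (b : ℕ → R) : appell b 0 = C (b 0) := by simp [appell]

theorem eval_appell_succ (b : ℕ → R) (m : ℕ) (x : R) :
    (appell b (m + 1)).eval x = x * (appell b m).eval x + (appell (b ∘ Nat.succ) m).eval x := by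
  simpa [blossom_const] using blossom_insert b (notMem_range_self (n := m)) fun _ => x

theorem coeff_appell (b : ℕ → R) (m k : ℕ) :
    (appell b m).coeff k = (m.choose k : R) * b (m - k) := by
  simp only [appell, finsetSum_coeff, coeff_C_mul_X_pow, sum_ite_eq, mem_range]
  split_ifs with h
  · rfl
  · simp [Nat.choose_eq_zero_of_lt (by lia : m < k)]

theorem natDegree_appell {b : ℕ → R} (hb : b 0 ≠ 0) (m : ℕ) : (appell b m).natDegree = m := by
  refine natDegree_eq_of_le_of_coeff_ne_zero ?_ (by simpa [coeff_appell] using hb)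
  refine natDegree_le_iff_coeff_eq_zero.2 fun k hk => ?_
  simp [coeff_appell, Nat.choose_eq_zero_of_lt hk]

theorem leadingCoeff_appell {b : ℕ → R} (hb : b 0 ≠ 0) (m : ℕ) :
    (appell b m).leadingCoeff = b 0 := by
  simp [leadingCoeff, natDegree_appell hb, coeff_appell]

theorem derivative_appell_succ (b : ℕ → R) (m : ℕ) :
    derivative (appell b (m + 1)) = C ((m + 1 : ℕ) : R) * appell b m := by
  ext k
  have h : ((m + 1).choose (k + 1) : R) * (k + 1) = (m + 1 : ℕ) * m.choose k := by
    exact_mod_cast congrArg (Nat.cast (R := R)) (Nat.add_one_mul_choose_eq m k).symm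
  rw [coeff_derivative, coeff_C_mul, coeff_appell, coeff_appell, Nat.add_sub_add_right,
    mul_right_comm, h, mul_assoc]

end Appell

section Region

variable {ι : Type*} {b : ℕ → ℝ} {U V : Finset ι} {x y : ι → ℝ}

/-- The region where `blossom b U` and all its partial derivatives are positive. -/
def posRegion (b : ℕ → ℝ) (U : Finset ι) : Set (ι → ℝ) :=
  {x | ∀ T ⊆ U, 0 < blossom b T x}

/-- The region where `blossom b U` and all its partial derivatives are nonnegative. -/
def nonnegRegion (b : ℕ → ℝ) (U : Finset ι) : Set (ι → ℝ) :=
  {x | ∀ T ⊆ U, 0 ≤ blossom b T x}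

theorem posRegion_subset_nonnegRegion : posRegion b U ⊆ nonnegRegion b U :=
  fun _ hx T hT => (hx T hT).le

theorem posRegion_anti (h : U ⊆ V) : posRegion b V ⊆ posRegion b U :=
  fun _ hx T hT => hx T (hT.trans h)

theorem nonnegRegion_anti (h : U ⊆ V) : nonnegRegion b V ⊆ nonnegRegion b U :=
  fun _ hx T hT => hx T (hT.trans h)

theorem mem_posRegion_congr (h : ∀ i ∈ U, x i = y i) :
    x ∈ posRegion b U ↔ y ∈ posRegion b U :=
  forall₂_congr fun _ hT => by rw [blossom_congr b fun i hi => h i (hT hi)]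

theorem comp_mem_posRegion_iff {κ : Type*} (e : κ ↪ ι) {U : Finset κ} :
    x ∘ e ∈ posRegion b U ↔ x ∈ posRegion b (U.map e) := by
  refine ⟨fun h T hT => ?_, fun h T hT => blossom_map b e T x ▸ h _ (map_subset_map.2 hT)⟩
  obtain ⟨S, hS, rfl⟩ := subset_map_iff.1 hT
  exact blossom_map b e S x ▸ h S hS

theorem const_mem_posRegion_iff {t : ℝ} :
    (fun _ => t) ∈ posRegion b U ↔ ∀ j ≤ #U, 0 < (appell b j).eval t := by
  refine ⟨fun h j hj => ?_, fun h T hT => blossom_const b T t ▸ h _ (card_le_card hT)⟩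
  obtain ⟨T, hT, rfl⟩ := exists_subset_card_eq hj
  exact blossom_const b T t ▸ h T hT

theorem const_mem_nonnegRegion_iff {t : ℝ} :
    (fun _ => t) ∈ nonnegRegion b U ↔ ∀ j ≤ #U, 0 ≤ (appell b j).eval t := by
  refine ⟨fun h j hj => ?_, fun h T hT => blossom_const b T t ▸ h _ (card_le_card hT)⟩
  obtain ⟨T, hT, rfl⟩ := exists_subset_card_eq hj
  exact blossom_const b T t ▸ h T hT

@[fun_prop]
theorem continuous_blossom (b : ℕ → ℝ) (U : Finset ι) : Continuous (blossom b U) := by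
  unfold blossom
  fun_prop

theorem isOpen_posRegion (b : ℕ → ℝ) (U : Finset ι) : IsOpen (posRegion b U) := by
  have h : posRegion b U = ⋂ T ∈ U.powerset, {x | 0 < blossom b T x} := by
    ext; simp [posRegion]
  exact h ▸ isOpen_biInter_finset fun T _ => isOpen_lt continuous_const (continuous_blossom b T)

theorem isClosed_nonnegRegion (b : ℕ → ℝ) (U : Finset ι) : IsClosed (nonnegRegion b U) := by
  have h : nonnegRegion b U = ⋂ T ∈ U.powerset, {x | 0 ≤ blossom b T x} := by
    ext; simp [nonnegRegion]
  exact h ▸ isClosed_biInter fun T _ => isClosed_le continuous_const (continuous_blossom b T)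

theorem closure_posRegion_subset : closure (posRegion b U) ⊆ nonnegRegion b U :=
  closure_minimal posRegion_subset_nonnegRegion (isClosed_nonnegRegion b U)

theorem blossom_add_mul_prod_le (hU : U.Nonempty) (hx : x ∈ nonnegRegion b U)
    (hxy : ∀ i ∈ U, x i ≤ y i) :
    blossom b U x + b 0 * ∏ i ∈ U, (y i - x i) ≤ blossom b U y := by
  classical
  have hsub : {U, ∅} ⊆ U.powerset := by simp [insert_subset_iff]
  calc blossom b U x + b 0 * ∏ i ∈ U, (y i - x i)
      = ∑ T ∈ {U, ∅}, blossom b T x * ∏ i ∈ U \ T, (y - x) i := by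
        simp [sum_pair hU.ne_empty]
    _ ≤ ∑ T ∈ U.powerset, blossom b T x * ∏ i ∈ U \ T, (y - x) i :=
        sum_le_sum_of_subset_of_nonneg hsub fun T hT _ =>
          mul_nonneg (hx T (mem_powerset.1 hT))
            (prod_nonneg fun i hi => sub_nonneg.2 (hxy i (sdiff_subset hi)))
    _ = blossom b U y := by rw [← blossom_add, add_sub_cancel]

theorem blossom_le_blossom (hx : x ∈ nonnegRegion b U) (hxy : ∀ i ∈ U, x i ≤ y i) :
    blossom b U x ≤ blossom b U y := by
  rcases U.eq_empty_or_nonempty with rfl | hU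
  · simp
  · have hb : 0 ≤ b 0 := blossom_empty b x ▸ hx ∅ (empty_subset U)
    have hprod := prod_nonneg fun i hi => sub_nonneg.2 (hxy i hi)
    exact (le_add_of_nonneg_right (mul_nonneg hb hprod)).trans
      (blossom_add_mul_prod_le hU hx hxy)

theorem mem_posRegion_of_lt (hb : 0 < b 0) (hx : x ∈ nonnegRegion b U)
    (hxy : ∀ i ∈ U, x i < y i) : y ∈ posRegion b U := by
  intro T hT
  rcases T.eq_empty_or_nonempty with rfl | hTne
  · simpa using hb
  · have hprod := prod_pos fun i hi => sub_pos.2 (hxy i (hT hi))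
    exact (add_pos_of_nonneg_of_pos (hx T hT) (mul_pos hb hprod)).trans_le <|
      blossom_add_mul_prod_le hTne (nonnegRegion_anti hT hx) fun i hi => (hxy i (hT hi)).le

theorem closure_posRegion (hb : 0 < b 0) : closure (posRegion b U) = nonnegRegion b U := by
  refine closure_posRegion_subset.antisymm fun x hx => ?_
  have hcont : Continuous fun ε : ℝ => x + fun _ => ε := by fun_prop
  have hlim : Tendsto (fun ε : ℝ => x + fun _ => ε) (𝓝[>] 0) (𝓝 x) :=
    (hcont.tendsto' 0 x (add_zero x)).mono_left nhdsWithin_le_nhds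
  refine mem_closure_of_tendsto hlim ?_
  filter_upwards [self_mem_nhdsWithin] with ε hε using
    mem_posRegion_of_lt hb hx fun i _ => lt_add_of_pos_right (x i) hε

theorem isUpperSet_posRegion (b : ℕ → ℝ) (U : Finset ι) : IsUpperSet (posRegion b U) :=
  fun _ _ hxy hx T hT => (hx T hT).trans_le <|
    blossom_le_blossom (nonnegRegion_anti hT (posRegion_subset_nonnegRegion hx)) fun i _ => hxy i

theorem blossom_singleton (b : ℕ → ℝ) (i : ι) (x : ι → ℝ) :
    blossom b {i} x = x i * b 0 + b 1 := by
  classical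
  rw [← insert_empty_eq, blossom_insert b (notMem_empty i), blossom_empty, blossom_empty]
  rfl

theorem neg_div_le_of_mem_nonnegRegion (hb : 0 < b 0) (hx : x ∈ nonnegRegion b U) {i : ι}
    (hi : i ∈ U) : -b 1 / b 0 ≤ x i := by
  have h := hx {i} (singleton_subset_iff.2 hi)
  rw [blossom_singleton] at h
  rw [div_le_iff₀ hb]
  linarith

theorem neg_div_lt_of_mem_posRegion (hx : x ∈ posRegion b U) {i : ι} (hi : i ∈ U) :
    -b 1 / b 0 < x i := by
  have hb : 0 < b 0 := blossom_empty b x ▸ hx ∅ (empty_subset U)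
  have h := hx {i} (singleton_subset_iff.2 hi)
  rw [blossom_singleton] at h
  rw [div_lt_iff₀ hb]
  linarith

theorem eventually_update_mem_posRegion_insert [DecidableEq ι] (hx : x ∈ posRegion b U) (i : ι) :
    ∀ᶠ t in atTop, Function.update x i t ∈ posRegion b (insert i U) := by
  have hlin : ∀ T ∈ U.powerset, ∀ᶠ t in atTop,
      0 < t * blossom b T x + blossom (b ∘ Nat.succ) T x := fun T hT =>
    (tendsto_atTop_add_const_right _ _
      (tendsto_id.atTop_mul_const (hx T (mem_powerset.1 hT)))).eventually_gt_atTop 0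
  filter_upwards [(eventually_all_finset _).2 hlin] with t ht T hT
  by_cases hiT : i ∈ T
  · rw [← insert_erase hiT, blossom_insert_update b (notMem_erase i T)]
    exact ht _ (mem_powerset.2 (subset_insert_iff.1 hT))
  · rw [blossom_update_of_notMem b hiT]
    exact hx T ((subset_insert_iff_of_notMem hiT).1 hT)

end Region

section Diagonal

variable {b : ℕ → ℝ} {m : ℕ} {s t : ℝ}

theorem eval_appell_le_eval_appell (hs : ∀ j ≤ m, 0 ≤ (appell b j).eval s) (hst : s ≤ t) :
    (appell b m).eval s ≤ (appell b m).eval t := by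
  have hmem : (fun _ => s) ∈ nonnegRegion b (range m) :=
    const_mem_nonnegRegion_iff.2 (by simpa using hs)
  simpa [blossom_const] using blossom_le_blossom hmem fun _ _ => hst

theorem eval_appell_pos_of_lt (hb : 0 < b 0) (hs : ∀ j ≤ m, 0 ≤ (appell b j).eval s)
    (hst : s < t) : ∀ j ≤ m, 0 < (appell b j).eval t := by
  have hmem : (fun _ => s) ∈ nonnegRegion b (range m) :=
    const_mem_nonnegRegion_iff.2 (by simpa using hs)
  simpa using const_mem_posRegion_iff.1 (mem_posRegion_of_lt hb hmem fun _ _ => hst)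

theorem eventually_eval_appell_pos (hb : 0 < b 0) (m : ℕ) :
    ∀ᶠ t in atTop, 0 < (appell b m).eval t := by
  cases m with
  | zero => exact Eventually.of_forall fun _ => by simpa using hb
  | succ m =>
    have hdeg : 0 < (appell b (m + 1)).degree :=
      natDegree_pos_iff_degree_pos.1 (by simp [natDegree_appell hb.ne'])
    exact (tendsto_atTop_of_leadingCoeff_nonneg _ hdeg
      (leadingCoeff_appell hb.ne' _ ▸ hb.le)).eventually_gt_atTop 0

theorem exists_const_mem_posRegion {ι : Type*} (hb : 0 < b 0) (U : Finset ι) :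
    ∃ t : ℝ, (fun _ => t) ∈ posRegion b U := by
  simp only [const_mem_posRegion_iff]
  exact ((Set.finite_Iic #U).eventually_all.2 fun j _ => eventually_eval_appell_pos hb j).exists

end Diagonal

section Stability

variable {ι : Type*} {b : ℕ → ℝ} {U W : Finset ι} {j l : ι} {x y : ι → ℝ}

/-- For `0 < b 0` this says that `posRegion b U` is relatively closed, hence a union of connected
components, in the set where `blossom b U` is positive. -/
def StableOn (b : ℕ → ℝ) (U : Finset ι) : Prop :=
  ∀ x ∈ nonnegRegion b U, 0 < blossom b U x → x ∈ posRegion b U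

theorem StableOn.subset_posRegion_of_isPreconnected (h : StableOn b U) {S : Set (ι → ℝ)}
    (hS : IsPreconnected S) (hpos : ∀ y ∈ S, 0 < blossom b U y) (hxS : x ∈ S)
    (hx : x ∈ posRegion b U) : S ⊆ posRegion b U :=
  hS.subset_of_closure_inter_subset (isOpen_posRegion b U) ⟨x, hxS, hx⟩
    fun y hy => h y (closure_posRegion_subset hy.1) (hpos y hy.2)

section DecidableEq

variable [DecidableEq ι]

-- If the inequality failed, the `j`-th coordinate could be lowered to the zero of
-- `blossom b (insert j W)` while keeping `blossom b (insert j (insert l W))` positive.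
theorem StableOn.blossom_mul_blossom_le (h : StableOn b (insert j (insert l W))) (hjl : j ≠ l)
    (hj : j ∉ W) (hl : l ∉ W) (hx : x ∈ posRegion b (insert j (insert l W))) :
    blossom b W x * blossom ((b ∘ Nat.succ) ∘ Nat.succ) W x
      ≤ blossom (b ∘ Nat.succ) W x ^ 2 := by
  by_contra! hlt
  have hA : 0 < blossom b W x := hx W (by grind)
  have hjpos := hx (insert j W) (by grind)
  have hlpos := hx (insert l W) (by grind)
  have hjl' : j ∉ insert l W := by simp [hjl, hj]
  set A := blossom b W x
  set B := blossom (b ∘ Nat.succ) W x with hB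
  set C := blossom ((b ∘ Nat.succ) ∘ Nat.succ) W x with hC
  have hle : -B / A ≤ x j := by
    rw [blossom_insert b hj] at hjpos
    rw [div_le_iff₀ hA]
    linarith
  have hpos : ∀ t ≥ -B / A, 0 < blossom b (insert j (insert l W)) (Function.update x j t) := by
    intro t ht
    have hsplit : blossom b (insert j (insert l W)) (Function.update x j t)
        = (t - -B / A) * blossom b (insert l W) x + (A * C - B ^ 2) / A := by
      rw [blossom_insert_update b hjl', blossom_insert b hl, blossom_insert _ hl, ← hB, ← hC]
      field_simp
      ring
    rw [hsplit]
    exact add_pos_of_nonneg_of_pos (mul_nonneg (sub_nonneg.2 ht) hlpos.le)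
      (div_pos (sub_pos.2 hlt) hA)
  have hsub := h.subset_posRegion_of_isPreconnected (x := x)
    (isPreconnected_Icc.image (Function.update x j) (by fun_prop))
    (Set.forall_mem_image.2 fun t ht => hpos t ht.1)
    ⟨x j, ⟨hle, le_rfl⟩, Function.update_eq_self _ _⟩ hx
  have hzero := hsub ⟨_, ⟨le_rfl, hle⟩, rfl⟩ (insert j W) (by grind)
  rw [blossom_insert_update b hj, div_mul_cancel₀ _ hA.ne', neg_add_cancel] at hzero
  exact hzero.false

theorem StableOn.blossom_succ_le_of_add_le (h : StableOn b (insert j (insert l W))) (hjl : j ≠ l)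
    (hj : j ∉ W) (hl : l ∉ W) (hx : x ∈ posRegion b (insert j (insert l W)))
    (hW : ∀ k ∈ W, y k = x k)
    (hy : blossom b (insert j (insert l W)) y = blossom b (insert j (insert l W)) x)
    (hsum : y j + y l ≤ x j + x l) :
    blossom (b ∘ Nat.succ) (insert j (insert l W)) x
      ≤ blossom (b ∘ Nat.succ) (insert j (insert l W)) y := by
  have hA : 0 < blossom b W x := hx W (by grind)
  have hdisc := h.blossom_mul_blossom_le hjl hj hl hx
  have hmul := mul_nonneg (sub_nonneg.2 hdisc) (sub_nonneg.2 hsum)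
  simp only [blossom_insert_insert _ hjl hj hl, blossom_congr _ hW] at hy ⊢
  refine le_of_mul_le_mul_left ?_ hA
  linear_combination hmul - blossom (b ∘ Nat.succ) W x * hy

theorem eventually_mul_add_div_lt_add {p q : ℝ} (hp : 0 < p) (hpq : p < q) :
    ∀ᶠ s in 𝓝[>] (1 : ℝ), s * p + q / s < p + q := by
  filter_upwards [self_mem_nhdsWithin,
    nhdsWithin_le_nhds (eventually_lt_nhds ((one_lt_div hp).2 hpq))] with s (hs : 1 < s) hsq
  have hdiff : p + q - (s * p + q / s) = (s - 1) * (q - s * p) / s := by field_simp; ring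
  have hpos : 0 < (s - 1) * (q - s * p) / s :=
    div_pos (mul_pos (sub_pos.2 hs) (sub_pos.2 ((lt_div_iff₀ hp).1 hsq))) (by linarith)
  linarith

-- With `β = B / A`, where `A` and `B` are the values of `blossom b W` and its codegree shift, the
-- level sets of the blossom in the coordinates `j`, `l` are the hyperbolas `(s + β) (t + β) = c`.
theorem exists_update_update_mem_posRegion (hjl : j ≠ l) (hj : j ∉ W) (hl : l ∉ W)
    (hx : x ∈ posRegion b (insert j (insert l W))) (hlt : x j < x l) :
    ∃ s t : ℝ, s + t < x j + x l ∧
      Function.update (Function.update x j s) l t ∈ posRegion b (insert j (insert l W)) ∧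
      blossom b (insert j (insert l W)) (Function.update (Function.update x j s) l t)
        = blossom b (insert j (insert l W)) x := by
  have hA : 0 < blossom b W x := hx W (by grind)
  have hjpos := hx (insert j W) (by grind)
  obtain ⟨β, hβ⟩ : ∃ β, blossom (b ∘ Nat.succ) W x = β * blossom b W x :=
    ⟨_, (div_mul_cancel₀ _ hA.ne').symm⟩
  have hp : 0 < x j + β := by
    rw [blossom_insert b hj, hβ, ← add_mul] at hjpos
    exact pos_of_mul_pos_left hjpos hA.le
  set y : ℝ → ι → ℝ := fun s =>
    Function.update (Function.update x j (s * (x j + β) - β)) l ((x l + β) / s - β) with hy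
  have hy1 : y 1 = x := by simp [hy]
  have hcont : ContinuousAt y 1 := by
    refine ContinuousAt.update (by fun_prop) l ?_
    fun_prop (disch := simp)
  have hmem : ∀ᶠ s in 𝓝[>] (1 : ℝ), y s ∈ posRegion b (insert j (insert l W)) :=
    nhdsWithin_le_nhds (hcont.eventually_mem ((isOpen_posRegion b _).mem_nhds (hy1.symm ▸ hx)))
  obtain ⟨s, hys, hsum, hs⟩ := (hmem.and ((eventually_mul_add_div_lt_add hp
    (add_lt_add_left hlt β)).and self_mem_nhdsWithin)).exists
  have hs0 : s ≠ 0 := (one_pos.trans hs).ne'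
  refine ⟨_, _, by linarith, hys, ?_⟩
  simp only [blossom_insert_insert _ hjl hj hl, blossom_update_of_notMem _ hl,
    blossom_update_of_notMem _ hj, Function.update_self, Function.update_of_ne hjl, hβ]
  field_simp
  ring

end DecidableEq

theorem StableOn.exists_sum_lt (h : StableOn b U) (hx : x ∈ posRegion b U) (hj : j ∈ U)
    (hl : l ∈ U) (hlt : x j < x l) :
    ∃ y ∈ posRegion b U, (∀ k ∉ U, y k = x k) ∧ blossom b U y = blossom b U x ∧
      blossom (b ∘ Nat.succ) U x ≤ blossom (b ∘ Nat.succ) U y ∧ ∑ k ∈ U, y k < ∑ k ∈ U, x k := by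
  classical
  have hjl : j ≠ l := fun hjl => hlt.ne (congrArg x hjl)
  obtain ⟨W, hjW, hlW, rfl⟩ : ∃ W : Finset ι, j ∉ W ∧ l ∉ W ∧ U = insert j (insert l W) :=
    ⟨(U.erase j).erase l, by simp, by simp, by
      rw [insert_erase (by simp [hl, hjl.symm]), insert_erase hj]⟩
  obtain ⟨s, t, hst, hymem, hyeq⟩ := exists_update_update_mem_posRegion hjl hjW hlW hx hlt
  set y := Function.update (Function.update x j s) l t with hy
  have hyj : y j = s := by simp [hy, hjl]
  have hyl : y l = t := by simp [hy]
  have hyk : ∀ k, k ≠ j → k ≠ l → y k = x k := fun k hkj hkl => by simp [hy, hkj, hkl]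
  have hyW : ∀ k ∈ W, y k = x k := fun k hk => hyk k (by grind) (by grind)
  have hyjl : y j + y l < x j + x l := by rwa [hyj, hyl]
  refine ⟨y, hymem, fun k hk => hyk k (by grind) (by grind), hyeq,
    h.blossom_succ_le_of_add_le hjl hjW hlW hx hyW hyeq hyjl.le, ?_⟩
  have hjW' : j ∉ insert l W := by simp [hjl, hjW]
  rw [sum_insert hjW', sum_insert hjW', sum_insert hlW, sum_insert hlW, sum_congr rfl hyW]
  linarith

theorem isCompact_nonnegRegion_inter_sum_le (hb : 0 < b 0) (U : Finset ι) (x : ι → ℝ) (r : ℝ) :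
    IsCompact (nonnegRegion b U ∩ {y | (∀ k ∉ U, y k = x k) ∧ ∑ k ∈ U, y k ≤ r}) := by
  classical
  set a := -b 1 / b 0
  refine (isCompact_Icc (a := fun k => if k ∈ U then a else x k)
    (b := fun k => if k ∈ U then a + (r - #U * a) else x k)).of_isClosed_subset ?_ ?_
  · simp only [Set.ofPred_and, Set.ofPred_forall]
    have hoff : IsClosed (⋂ k, ⋂ (_ : k ∉ U), {y : ι → ℝ | y k = x k}) :=
      isClosed_iInter fun k => isClosed_iInter fun _ =>
        isClosed_eq (continuous_apply k) continuous_const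
    exact (isClosed_nonnegRegion b U).inter
      (hoff.inter (isClosed_le (by fun_prop) continuous_const))
  rintro y ⟨hy, hyx, hyr⟩
  have hlow : ∀ k ∈ U, a ≤ y k := fun k hk => neg_div_le_of_mem_nonnegRegion hb hy hk
  refine ⟨fun k => ?_, fun k => ?_⟩ <;> by_cases hk : k ∈ U <;> simp only [hk, if_true, if_false]
  · exact hlow k hk
  · exact (hyx k hk).ge
  · have hsingle := single_le_sum (f := fun k => y k - a) (fun k hk => sub_nonneg.2 (hlow k hk)) hk
    simp only [sum_sub_distrib, sum_const, nsmul_eq_mul] at hsingle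
    linarith
  · exact (hyx k hk).le

-- Minimise the sum of the coordinates over the points of the level set at which the codegree shift
-- has not decreased: by `StableOn.exists_sum_lt` a minimiser is constant on `U`.
theorem StableOn.exists_const_blossom_succ_le (h : StableOn b U) (hx : x ∈ posRegion b U) :
    ∃ t : ℝ, (fun _ => t) ∈ posRegion b U ∧ (appell b #U).eval t = blossom b U x ∧
      blossom (b ∘ Nat.succ) U x ≤ (appell (b ∘ Nat.succ) #U).eval t := by
  have hb : 0 < b 0 := blossom_empty b x ▸ hx ∅ (empty_subset U)
  have hclosed : IsClosed {y | blossom b U y = blossom b U x ∧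
      blossom (b ∘ Nat.succ) U x ≤ blossom (b ∘ Nat.succ) U y} :=
    (isClosed_eq (continuous_blossom b U) continuous_const).inter
      (isClosed_le continuous_const (continuous_blossom _ U))
  obtain ⟨y, ⟨⟨hy, hyx, hysum⟩, hyeq, hyle⟩, hmin⟩ :=
    ((isCompact_nonnegRegion_inter_sum_le hb U x (∑ k ∈ U, x k)).inter_right hclosed).exists_isMinOn
      ⟨x, ⟨posRegion_subset_nonnegRegion hx, fun _ _ => rfl, le_rfl⟩, rfl, le_rfl⟩
      (f := fun y => ∑ k ∈ U, y k) (by fun_prop)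
  have hypos : y ∈ posRegion b U := h y hy (hyeq ▸ hx U subset_rfl)
  have hconst : ∀ j ∈ U, ∀ l ∈ U, y l ≤ y j := by
    intro j hj l hl
    by_contra! hlt
    obtain ⟨z, hz, hzy, hzeq, hzle, hzsum⟩ := h.exists_sum_lt hypos hj hl hlt
    exact hzsum.not_ge <| hmin ⟨⟨posRegion_subset_nonnegRegion hz,
      fun k hk => (hzy k hk).trans (hyx k hk), hzsum.le.trans hysum⟩,
      hzeq.trans hyeq, hyle.trans hzle⟩
  obtain ⟨t, ht⟩ : ∃ t, ∀ k ∈ U, y k = t := by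
    rcases U.eq_empty_or_nonempty with rfl | ⟨j, hj⟩
    · exact ⟨0, by simp⟩
    · exact ⟨y j, fun k hk => le_antisymm (hconst j hj k hk) (hconst k hk j hj)⟩
  have heval (a : ℕ → ℝ) : (appell a #U).eval t = blossom a U y :=
    (blossom_const a U t).symm.trans (blossom_congr a ht).symm
  exact ⟨t, (mem_posRegion_congr ht).1 hypos, (heval b).trans hyeq, (heval _).symm ▸ hyle⟩

theorem StableOn.blossom_succ_le_of_blossom_eq_zero (h : StableOn b U) (hb : 0 < b 0)
    (hx : x ∈ nonnegRegion b U) (hx0 : blossom b U x = 0) {z : ℝ}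
    (hz : (fun _ => z) ∈ nonnegRegion b U) (hz0 : (appell b #U).eval z = 0) :
    blossom (b ∘ Nat.succ) U x ≤ (appell (b ∘ Nat.succ) #U).eval z := by
  have hpos : ∀ ε > 0, (x + fun _ => ε) ∈ posRegion b U := fun ε hε =>
    mem_posRegion_of_lt hb hx fun i _ => lt_add_of_pos_right (x i) hε
  choose! t htmem hteq htle using fun ε hε => h.exists_const_blossom_succ_le (hpos ε hε)
  simp only [const_mem_posRegion_iff, const_mem_nonnegRegion_iff] at htmem hz
  have hlim (a : ℕ → ℝ) :
      Tendsto (fun ε : ℝ => blossom a U (x + fun _ => ε)) (𝓝[>] 0) (𝓝 (blossom a U x)) := by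
    have hcont : Continuous fun ε : ℝ => blossom a U (x + fun _ => ε) := by fun_prop
    exact (hcont.tendsto' 0 _ (congrArg _ (add_zero x))).mono_left nhdsWithin_le_nhds
  have ht : Tendsto t (𝓝[>] 0) (𝓝 z) := by
    refine tendsto_order.2 ⟨fun a ha => ?_, fun w hw => ?_⟩
    · filter_upwards [self_mem_nhdsWithin] with ε hε
      refine ha.trans (not_le.1 fun hle => ?_)
      exact (hz0 ▸ eval_appell_le_eval_appell (fun j hj => (htmem ε hε j hj).le) hle).not_gt
        (htmem ε hε _ le_rfl)
    · have hwpos := eval_appell_pos_of_lt hb hz hw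
      filter_upwards [self_mem_nhdsWithin,
        (hlim b).eventually_lt_const (hx0 ▸ hwpos _ le_rfl)] with ε hε hlt
      refine not_le.1 fun hle => hlt.not_ge (hteq ε hε ▸ ?_)
      exact eval_appell_le_eval_appell (fun j hj => (hwpos j hj).le) hle
  refine le_of_tendsto_of_tendsto (hlim _)
    (((appell (b ∘ Nat.succ) #U).continuous.tendsto z).comp ht) ?_
  filter_upwards [self_mem_nhdsWithin] with ε hε using htle ε hε

theorem StableOn.blossom_insert_le_of_blossom_eq_zero [DecidableEq ι] (h : StableOn b U)
    (hb : 0 < b 0) {i : ι} (hi : i ∉ U) (hx : x ∈ nonnegRegion b U) (hx0 : blossom b U x = 0)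
    {z : ℝ} (hz : (fun _ => z) ∈ nonnegRegion b U) (hz0 : (appell b #U).eval z = 0) :
    blossom b (insert i U) x ≤ (appell b (#U + 1)).eval z := by
  rw [blossom_insert b hi, eval_appell_succ, hx0, hz0, mul_zero, mul_zero, zero_add, zero_add]
  exact h.blossom_succ_le_of_blossom_eq_zero hb hx hx0 hz hz0

end Stability

section RightNoetherian

variable {ι : Type*} {b : ℕ → ℝ} {U : Finset ι} {x : ι → ℝ} {m : ℕ}

theorem isRoot_iterate_derivative_appell_succ {k : ℕ} {y : ℝ} :
    (derivative^[k + 1] (appell b (m + 1))).IsRoot y ↔ (derivative^[k] (appell b m)).IsRoot y := by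
  rw [Function.iterate_succ_apply, derivative_appell_succ, iterate_derivative_C_mul, root_mul,
    or_iff_right (not_isRoot_C _ _ (Nat.cast_ne_zero.2 m.succ_ne_zero))]

theorem isRoot_derivative_appell_succ {y : ℝ} :
    (derivative (appell b (m + 1))).IsRoot y ↔ (appell b m).IsRoot y :=
  isRoot_iterate_derivative_appell_succ (k := 0)

theorem rightNoetherian_appell_succ (hb : 0 < b 0) :
    RightNoetherian (appell b (m + 1)) ↔
      (∃ x, (appell b (m + 1)).IsRoot x ∧ ∀ y, (appell b m).IsRoot y → y ≤ x) ∧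
        RightNoetherian (appell b m) := by
  simp only [RightNoetherian, natDegree_appell hb.ne', Nat.forall_lt_succ_left,
    isRoot_iterate_derivative_appell_succ, Function.iterate_zero, id]

theorem strictlyRightNoetherian_appell_succ :
    StrictlyRightNoetherian (appell b (m + 1)) ↔ RightNoetherian (appell b (m + 1)) ∧
      ∃ x, (appell b (m + 1)).IsRoot x ∧ ∀ y, (appell b m).IsRoot y → y < x := by
  simp only [StrictlyRightNoetherian, isRoot_derivative_appell_succ]

theorem eventually_forall_mul_add_pos {X : Type*} [TopologicalSpace X] {K : Set X} {f g : X → ℝ}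
    (hK : IsCompact K) (hf : ContinuousOn f K) (hg : ContinuousOn g K) (hpos : ∀ x ∈ K, 0 < f x) :
    ∀ᶠ t in atTop, ∀ x ∈ K, 0 < t * f x + g x := by
  obtain ⟨M, hM⟩ := hK.bddAbove_image ((hg.neg).div hf fun x hx => (hpos x hx).ne')
  filter_upwards [eventually_gt_atTop M] with t ht x hx
  have h := (hM (Set.mem_image_of_mem _ hx)).trans_lt ht
  have := (div_lt_iff₀ (hpos x hx)).1 h
  simp only [Pi.neg_apply] at this
  linarith

theorem StableOn.of_insert [DecidableEq ι] {i : ι} (h : StableOn b (insert i U)) (hb : 0 < b 0)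
    (hi : i ∉ U) : StableOn b U := by
  intro x hx hpos
  set K := Set.Icc x (x + 1)
  have hle : x ≤ x + 1 := le_add_of_nonneg_right zero_le_one
  have hKpos : ∀ y ∈ K, 0 < blossom b U y := fun y hy =>
    hpos.trans_le (blossom_le_blossom hx fun i _ => hy.1 i)
  have hx1 : x + 1 ∈ posRegion b U := mem_posRegion_of_lt hb hx fun i _ => lt_add_one (x i)
  obtain ⟨t, htK, htx⟩ := ((eventually_forall_mul_add_pos isCompact_Icc
    (continuous_blossom b U).continuousOn (continuous_blossom (b ∘ Nat.succ) U).continuousOn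
    hKpos).and (eventually_update_mem_posRegion_insert hx1 i)).exists
  have hsub := h.subset_posRegion_of_isPreconnected
    ((convex_Icc x (x + 1)).isPreconnected.image (fun y => Function.update y i t) (by fun_prop))
    (Set.forall_mem_image.2 fun y hy => blossom_insert_update b hi y t ▸ htK y hy)
    ⟨x + 1, ⟨hle, le_rfl⟩, rfl⟩ htx
  have hmem := posRegion_anti (subset_insert i U) (hsub ⟨x, ⟨le_rfl, hle⟩, rfl⟩)
  refine (mem_posRegion_congr fun k hk => ?_).1 hmem
  exact Function.update_of_ne (ne_of_mem_of_not_mem hk hi) _ _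

-- The root is the infimum of the diagonal part of `posRegion b U`.
theorem StableOn.exists_isRoot_appell (h : StableOn b U) (hb : 0 < b 0) (hU : U.Nonempty) :
    ∃ z, (appell b #U).IsRoot z ∧ ∀ j ≤ #U, 0 ≤ (appell b j).eval z := by
  set Z : Set ℝ := {t | (fun _ => t) ∈ posRegion b U}
  have hdiag : Continuous fun (t : ℝ) (_ : ι) => t := by fun_prop
  have hZne : Z.Nonempty := exists_const_mem_posRegion hb U
  obtain ⟨i, hi⟩ := hU
  have hZbdd : BddBelow Z := ⟨-b 1 / b 0, fun t ht => (neg_div_lt_of_mem_posRegion ht hi).le⟩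
  have hnonneg : (fun _ => sInf Z) ∈ nonnegRegion b U := closure_posRegion_subset <|
    hdiag.closure_preimage_subset _ (csInf_mem_closure hZne hZbdd)
  refine ⟨sInf Z, ?_, const_mem_nonnegRegion_iff.1 hnonneg⟩
  by_contra hroot
  have hpos : 0 < blossom b U (fun _ => sInf Z) :=
    (hnonneg U subset_rfl).lt_of_ne' (blossom_const b U (sInf Z) ▸ hroot)
  have hZopen : IsOpen Z := (isOpen_posRegion b U).preimage hdiag
  obtain ⟨t, htlt, htZ⟩ := (hZopen.eventually_mem (h _ hnonneg hpos)).exists_lt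
  exact htlt.not_ge (csInf_le hZbdd htZ)

theorem StableOn.rightNoetherian (h : StableOn b U) (hb : 0 < b 0) :
    RightNoetherian (appell b #U) := by
  classical
  induction U using Finset.induction_on with
  | empty => simp [RightNoetherian]
  | insert i U hi ih =>
    obtain ⟨z, hz, hznonneg⟩ := h.exists_isRoot_appell hb (insert_nonempty i U)
    rw [card_insert_of_notMem hi] at hz hznonneg ⊢
    refine (rightNoetherian_appell_succ hb).2 ⟨⟨z, hz, fun y hy => ?_⟩, ih (h.of_insert hb hi)⟩
    by_contra! hlt
    exact (eval_appell_pos_of_lt hb hznonneg hlt _ (Nat.le_succ _)).ne' hy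

theorem forall_le_succ_iff {p : ℕ → Prop} : (∀ j ≤ m + 1, p j) ↔ (∀ j ≤ m, p j) ∧ p (m + 1) := by
  simp only [← Nat.lt_succ_iff, Nat.forall_lt_succ_right]

theorem StableOn.exists_isRoot_appell_and_blossom_insert_le [DecidableEq ι] {i : ι}
    (h : StableOn b U) (hb : 0 < b 0) (hi : i ∉ U) (hx : x ∈ nonnegRegion b U)
    (hx0 : blossom b U x = 0) :
    ∃ z, (appell b #U).IsRoot z ∧ (∀ j ≤ #U, 0 ≤ (appell b j).eval z) ∧
      blossom b (insert i U) x ≤ (appell b (#U + 1)).eval z := by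
  have hU : U.Nonempty := by
    rw [nonempty_iff_ne_empty]
    rintro rfl
    exact hb.ne' (blossom_empty b x ▸ hx0)
  obtain ⟨z, hz, hznonneg⟩ := h.exists_isRoot_appell hb hU
  exact ⟨z, hz, hznonneg, h.blossom_insert_le_of_blossom_eq_zero hb hi hx hx0
    (const_mem_nonnegRegion_iff.2 hznonneg) hz⟩

theorem StableOn.blossom_pos_of_forall_isRoot_le [DecidableEq ι] {i : ι} {w : ℝ}
    (h : StableOn b U) (hb : 0 < b 0) (hi : i ∉ U) (hw : (appell b (#U + 1)).IsRoot w)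
    (hle : ∀ y, (appell b #U).IsRoot y → y ≤ w) (hx : x ∈ nonnegRegion b U)
    (hpos : 0 < blossom b (insert i U) x) : 0 < blossom b U x := by
  refine (hx U subset_rfl).lt_of_ne' fun hx0 => ?_
  obtain ⟨z, hz, hznonneg, hxz⟩ := h.exists_isRoot_appell_and_blossom_insert_le hb hi hx hx0
  have hzpos := hpos.trans_le hxz
  have hzw := eval_appell_le_eval_appell (forall_le_succ_iff.2 ⟨hznonneg, hzpos.le⟩) (hle z hz)
  exact (hzpos.trans_le hzw).ne' hw

theorem StableOn.blossom_pos_of_forall_isRoot_lt [DecidableEq ι] {i : ι} {w : ℝ}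
    (h : StableOn b U) (hb : 0 < b 0) (hi : i ∉ U) (hw : (appell b (#U + 1)).IsRoot w)
    (hlt : ∀ y, (appell b #U).IsRoot y → y < w) (hx : x ∈ nonnegRegion b (insert i U)) :
    0 < blossom b U x := by
  refine (hx U (subset_insert i U)).lt_of_ne' fun hx0 => ?_
  obtain ⟨z, hz, hznonneg, hxz⟩ := h.exists_isRoot_appell_and_blossom_insert_le hb hi
    (nonnegRegion_anti (subset_insert i U) hx) hx0
  have hznonneg' := (hx _ subset_rfl).trans hxz
  exact (eval_appell_pos_of_lt hb (forall_le_succ_iff.2 ⟨hznonneg, hznonneg'⟩)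
    (hlt z hz) _ le_rfl).ne' hw

theorem stableOn_of_rightNoetherian (hb : 0 < b 0) (U : Finset ι)
    (h : RightNoetherian (appell b #U)) : StableOn b U := by
  classical
  induction U using Finset.strongInduction with
  | H U ih =>
    intro x hx hpos T hT
    rcases hT.eq_or_ssubset with rfl | hT
    · exact hpos
    obtain ⟨i, hiU, hiT⟩ := exists_of_ssubset hT
    rw [← card_erase_add_one hiU, rightNoetherian_appell_succ hb] at h
    rw [← insert_erase hiU] at hpos
    obtain ⟨⟨w, hw, hle⟩, hN⟩ := h
    have hstable := ih _ (erase_ssubset hiU) hN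
    have hxi := nonnegRegion_anti (erase_subset i U) hx
    exact hstable x hxi (hstable.blossom_pos_of_forall_isRoot_le hb (notMem_erase i U) hw hle hxi
      hpos) T (subset_erase.2 ⟨hT.subset, hiT⟩)

end RightNoetherian

section Component

theorem isPreconnected_of_isUpperSet {ι : Type*} {S : Set (ι → ℝ)} (hS : IsUpperSet S) :
    IsPreconnected S := by
  refine isPreconnected_of_forall_pair fun x hx y hy =>
    ⟨Set.Icc x (x ⊔ y) ∪ Set.Icc y (x ⊔ y), ?_, Or.inl (Set.left_mem_Icc.2 le_sup_left),
      Or.inr (Set.left_mem_Icc.2 le_sup_right), ?_⟩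
  · exact Set.union_subset (fun _ hz => hS hz.1 hx) fun _ hz => hS hz.1 hy
  · exact IsPreconnected.union (x ⊔ y) (Set.right_mem_Icc.2 le_sup_left)
      (Set.right_mem_Icc.2 le_sup_right) (convex_Icc _ _).isPreconnected
      (convex_Icc _ _).isPreconnected

section TopologicalSpace

variable {X : Type*} [TopologicalSpace X] {S G P : Set X} {x : X}

theorem IsConnComponent.subset (h : IsConnComponent S G) : G ⊆ S := by
  obtain ⟨x, -, rfl⟩ := h
  exact connectedComponentIn_subset _ _

theorem IsConnComponent.nonempty (h : IsConnComponent S G) : G.Nonempty := by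
  obtain ⟨x, hx, rfl⟩ := h
  exact ⟨x, mem_connectedComponentIn hx⟩

theorem IsConnComponent.subset_of_isPreconnected (h : IsConnComponent S G)
    (hP : IsPreconnected P) (hPS : P ⊆ S) (hxP : x ∈ P) (hxG : x ∈ G) : P ⊆ G := by
  obtain ⟨x, -, rfl⟩ := h
  rw [connectedComponentIn_eq hxG]
  exact hP.subset_connectedComponentIn hxP hPS

theorem IsConnComponent.isOpen [LocallyConnectedSpace X] (h : IsConnComponent S G)
    (hS : IsOpen S) : IsOpen G := by
  obtain ⟨x, -, rfl⟩ := h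
  exact hS.connectedComponentIn

end TopologicalSpace

theorem StableOn.isConnComponent_posRegion {ι : Type*} {b : ℕ → ℝ} {U : Finset ι}
    (h : StableOn b U) (hb : 0 < b 0) :
    IsConnComponent {x | 0 < blossom b U x} (posRegion b U) := by
  obtain ⟨t, ht⟩ := exists_const_mem_posRegion hb U
  have htU := ht U subset_rfl
  refine ⟨_, htU, Set.Subset.antisymm ?_ ?_⟩
  · exact (isPreconnected_of_isUpperSet (isUpperSet_posRegion b U)).subset_connectedComponentIn ht
      fun y hy => hy U subset_rfl
  · exact h.subset_posRegion_of_isPreconnected isPreconnected_connectedComponentIn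
      (connectedComponentIn_subset {x | 0 < blossom b U x} _) (mem_connectedComponentIn htU) ht

variable {n : ℕ} {b : ℕ → ℝ} {G : Set (Fin n → ℝ)} {x : Fin n → ℝ}

theorem upsilonStable_posRegion (b : ℕ → ℝ) :
    UpsilonStable (posRegion b (univ : Finset (Fin n))) := by
  refine ⟨fun _ => -b 1 / b 0, fun x hx => ⟨x - fun _ => -b 1 / b 0, fun i => ?_, ?_⟩⟩
  · exact sub_pos.2 (neg_div_lt_of_mem_posRegion hx (mem_univ i))
  · exact add_sub_cancel _ x

theorem IsConnComponent.blossom_erase_pos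
    (hG : IsConnComponent {x : Fin n → ℝ | 0 < blossom b univ x} G) (hst : UpsilonStable G)
    (hx : x ∈ G) (i : Fin n) : 0 < blossom b (univ.erase i) x := by
  by_contra! hle
  have hsub : Function.update x i '' Set.Iic (x i) ⊆ G := by
    refine hG.subset_of_isPreconnected (isPreconnected_Iic.image _ (by fun_prop))
      (Set.image_subset_iff.2 fun t ht => ?_)
      ⟨x i, Set.self_mem_Iic, Function.update_eq_self _ _⟩ hx
    have hxpos : 0 < blossom b univ x := hG.subset hx
    rw [Set.mem_preimage, Set.mem_ofPred_eq, blossom_update b (mem_univ i)]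
    exact add_pos_of_pos_of_nonneg hxpos
      (mul_nonneg_of_nonpos_of_nonpos (sub_nonpos.2 ht) hle)
  obtain ⟨q, hq⟩ := hst
  obtain ⟨v, hv, hvx⟩ := hq (hsub ⟨min (x i) (q i), Set.mem_Iic.2 (min_le_left _ _), rfl⟩)
  have hqi : q i + v i = min (x i) (q i) := by simpa using congrFun hvx i
  linarith [hv i, min_le_right (x i) (q i)]

theorem IsConnComponent.update_mem
    (hG : IsConnComponent {x : Fin n → ℝ | 0 < blossom b univ x} G) (hst : UpsilonStable G)
    (hx : x ∈ G) (i : Fin n) {t : ℝ} (ht : x i ≤ t) : Function.update x i t ∈ G := by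
  refine hG.subset_of_isPreconnected
    (isPreconnected_Ici.image (Function.update x i) (by fun_prop))
    (Set.image_subset_iff.2 fun s hs => ?_) ⟨x i, Set.self_mem_Ici, Function.update_eq_self _ _⟩ hx
    ⟨t, ht, rfl⟩
  have hxpos : 0 < blossom b univ x := hG.subset hx
  rw [Set.mem_preimage, Set.mem_ofPred_eq, blossom_update b (mem_univ i)]
  exact add_pos_of_pos_of_nonneg hxpos
    (mul_nonneg (sub_nonneg.2 hs) (hG.blossom_erase_pos hst hx i).le)

-- A negative partial derivative would become the leading coefficient in some coordinate, which can
-- be increased indefinitely within `G`.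
theorem IsConnComponent.subset_nonnegRegion
    (hG : IsConnComponent {x : Fin n → ℝ | 0 < blossom b univ x} G) (hst : UpsilonStable G) :
    G ⊆ nonnegRegion b univ := by
  suffices h : ∀ S : Finset (Fin n), ∀ x ∈ G, 0 ≤ blossom b Sᶜ x from
    fun x hx T _ => compl_compl T ▸ h Tᶜ x hx
  intro S
  induction S using Finset.induction_on with
  | empty =>
    intro x hx
    have hpos : 0 < blossom b univ x := hG.subset hx
    simpa only [compl_empty] using hpos.le
  | insert i S hi ih =>
    intro x hx
    set T := (insert i S)ᶜ with hT
    have hiT : i ∉ T := by simp [hT]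
    have hTS : insert i T = Sᶜ := by rw [hT, compl_insert, insert_erase (mem_compl.2 hi)]
    by_contra! hneg
    have htend := tendsto_atBot_add_const_right atTop (blossom (b ∘ Nat.succ) T x)
      (tendsto_id.atTop_mul_const_of_neg hneg)
    obtain ⟨t, ht, htx⟩ := ((htend.eventually_lt_atBot 0).and (eventually_ge_atTop (x i))).exists
    have hnonneg := ih _ (hG.update_mem hst hx i htx)
    rw [← hTS, blossom_insert_update b hiT] at hnonneg
    exact hnonneg.not_gt ht

theorem IsConnComponent.eq_posRegion
    (hG : IsConnComponent {x : Fin n → ℝ | 0 < blossom b univ x} G) (hst : UpsilonStable G)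
    (hb : 0 < b 0) : G = posRegion b univ := by
  have hopen : IsOpen G := hG.isOpen (isOpen_lt continuous_const (continuous_blossom b univ))
  have hsub : G ⊆ posRegion b univ := fun x hx => by
    have hcont : Continuous fun ε : ℝ => x - fun _ => ε := by fun_prop
    have hlim : Tendsto (fun ε : ℝ => x - fun _ => ε) (𝓝[>] 0) (𝓝 x) :=
      (hcont.tendsto' 0 x (sub_zero x)).mono_left nhdsWithin_le_nhds
    obtain ⟨ε, hεG, hε⟩ := ((hlim.eventually_mem (hopen.mem_nhds hx)).and
      self_mem_nhdsWithin).exists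
    exact mem_posRegion_of_lt hb (hG.subset_nonnegRegion hst hεG) fun i _ => sub_lt_self (x i) hε
  obtain ⟨x, hx⟩ := hG.nonempty
  exact hsub.antisymm <| hG.subset_of_isPreconnected
    (isPreconnected_of_isUpperSet (isUpperSet_posRegion b univ)) (fun y hy => hy univ subset_rfl)
    (hsub hx) hx

theorem stableOn_of_isConnComponent_posRegion {ι : Type*} {U : Finset ι} (hb : 0 < b 0)
    (h : IsConnComponent {x | 0 < blossom b U x} (posRegion b U)) : StableOn b U := by
  intro x hx hpos
  have hle : x ≤ x + 1 := le_add_of_nonneg_right zero_le_one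
  have hx1 : x + 1 ∈ posRegion b U := mem_posRegion_of_lt hb hx fun i _ => lt_add_one (x i)
  have hsub : Set.Icc x (x + 1) ⊆ {x | 0 < blossom b U x} := fun y hy =>
    hpos.trans_le (blossom_le_blossom hx fun i _ => hy.1 i)
  exact h.subset_of_isPreconnected (convex_Icc _ _).isPreconnected hsub
    (Set.right_mem_Icc.2 hle) hx1 (Set.left_mem_Icc.2 hle)

theorem exists_isConnComponent_upsilonStable_iff (hb : 0 < b 0) :
    (∃ G, IsConnComponent {x : Fin n → ℝ | 0 < blossom b univ x} G ∧ UpsilonStable G) ↔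
      RightNoetherian (appell b n) := by
  constructor
  · rintro ⟨G, hG, hst⟩
    rw [hG.eq_posRegion hst hb] at hG
    simpa using (stableOn_of_isConnComponent_posRegion hb hG).rightNoetherian hb
  · intro h
    have hstable := stableOn_of_rightNoetherian hb (univ : Finset (Fin n)) (by simpa using h)
    exact ⟨_, hstable.isConnComponent_posRegion hb, upsilonStable_posRegion b⟩

end Component

section Strict

variable {m : ℕ} {b : ℕ → ℝ} {G : Set (Fin (m + 1) → ℝ)} {x y : Fin (m + 1) → ℝ}

theorem dropLast_one_eq_iff : dropLast 1 x = dropLast 1 y ↔ ∀ i ≠ Fin.last m, x i = y i := by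
  refine ⟨fun h i hi => ?_, fun h => funext fun i => h _ (Fin.castSucc_lt_last i).ne⟩
  obtain ⟨k, rfl⟩ := Fin.exists_castSucc_eq.2 hi
  exact congrFun h k

theorem dropLast_mem_image_posRegion_iff :
    dropLast 1 x ∈ dropLast 1 '' posRegion b univ ↔
      x ∈ posRegion b (univ.erase (Fin.last m)) := by
  constructor
  · rintro ⟨y, hy, hyx⟩
    exact (mem_posRegion_congr fun i hi => dropLast_one_eq_iff.1 hyx i (ne_of_mem_erase hi)).1
      (posRegion_anti (subset_univ _) hy)
  · intro hx
    obtain ⟨t, ht⟩ := (eventually_update_mem_posRegion_insert hx (Fin.last m)).exists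
    rw [insert_erase (mem_univ _)] at ht
    exact ⟨_, ht, dropLast_one_eq_iff.2 fun i hi => Function.update_of_ne hi _ _⟩

theorem mem_upsilonCone_posRegion_iff :
    x ∈ upsilonCone 1 (posRegion b univ) ↔ ∀ i, x ∈ posRegion b (univ.erase i) := by
  have hperm (s : Equiv.Perm (Fin (m + 1))) :
      dropLast 1 (fun i => x (s i)) ∈ dropLast 1 '' posRegion b univ ↔
        x ∈ posRegion b (univ.erase (s (Fin.last m))) := by
    rw [dropLast_mem_image_posRegion_iff]
    have h := comp_mem_posRegion_iff (b := b) (x := x) s.toEmbedding (U := univ.erase (Fin.last m))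
    rwa [map_erase, map_univ_equiv] at h
  simp only [upsilonCone, Set.mem_ofPred_eq, hperm]
  exact ⟨fun h i => by simpa using h (Equiv.swap (Fin.last m) i), fun h s => h _⟩

theorem StableOn.frontier_posRegion_subset_upsilonCone_iff
    (h : StableOn b (univ : Finset (Fin (m + 1)))) (hb : 0 < b 0) :
    frontier (posRegion b univ) ⊆ upsilonCone 1 (posRegion b (univ : Finset (Fin (m + 1)))) ↔
      ∃ x, (appell b (m + 1)).IsRoot x ∧ ∀ y, (appell b m).IsRoot y → y < x := by
  rw [(isOpen_posRegion b univ).frontier_eq, closure_posRegion hb]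
  constructor
  · intro hsub
    obtain ⟨z, hz, hznonneg⟩ := h.exists_isRoot_appell hb univ_nonempty
    have hnot : (fun _ => z) ∉ posRegion b (univ : Finset (Fin (m + 1))) := fun hmem =>
      (const_mem_posRegion_iff.1 hmem _ le_rfl).ne' hz
    have hcone := hsub ⟨const_mem_nonnegRegion_iff.2 hznonneg, hnot⟩
    have hzpos := const_mem_posRegion_iff.1 (mem_upsilonCone_posRegion_iff.1 hcone (Fin.last m))
    rw [card_erase_of_mem (mem_univ _), card_fin, Nat.add_sub_cancel] at hzpos
    rw [card_fin] at hz
    refine ⟨z, hz, fun y hy => not_le.1 fun hle => ?_⟩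
    have hzy := eval_appell_le_eval_appell (fun j hj => (hzpos j hj).le) hle
    exact ((hzpos m le_rfl).trans_le hzy).ne' hy
  · rintro ⟨w, hw, hlt⟩ x ⟨hx, -⟩
    refine mem_upsilonCone_posRegion_iff.2 fun i => ?_
    have hi := notMem_erase i (univ : Finset (Fin (m + 1)))
    have hcard : #((univ : Finset (Fin (m + 1))).erase i) = m := by simp
    rw [← insert_erase (mem_univ i)] at h hx
    have hstable := h.of_insert hb hi
    exact hstable x (nonnegRegion_anti (subset_insert _ _) hx)
      (hstable.blossom_pos_of_forall_isRoot_lt hb hi (by rwa [hcard]) (by rwa [hcard]) hx)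

theorem IsConnComponent.strictlyUpsilonStable_iff
    (hG : IsConnComponent {x : Fin (m + 1) → ℝ | 0 < blossom b univ x} G)
    (hst : UpsilonStable G) (hb : 0 < b 0) :
    StrictlyUpsilonStable G ↔ StrictlyRightNoetherian (appell b (m + 1)) := by
  obtain rfl := hG.eq_posRegion hst hb
  have hN := (exists_isConnComponent_upsilonStable_iff hb).1 ⟨_, hG, hst⟩
  have hfrontier := (stableOn_of_isConnComponent_posRegion hb
    hG).frontier_posRegion_subset_upsilonCone_iff hb
  rw [StrictlyUpsilonStable, and_iff_right hst, hfrontier, strictlyRightNoetherian_appell_succ,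
    and_iff_right hN]

end Strict

section Poly

variable {n : ℕ} (c : Fin n → ℝ)

/-- The coefficients of `poly n c` indexed by codegree: `1, -c_{n-1}, …, -c_0`, extended by zero. -/
def codegCoeff : ℕ → ℝ
  | 0 => 1
  | j + 1 => if h : j < n then -c (Fin.rev ⟨j, h⟩) else 0

@[simp]
theorem codegCoeff_zero : codegCoeff c 0 = 1 := rfl

theorem codegCoeff_sub (k : Fin n) : codegCoeff c (n - k) = -c k := by
  have hrev : n - k = Fin.rev k + 1 := by
    rw [Fin.val_rev]
    lia
  rw [hrev, codegCoeff, dif_pos (Fin.rev k).isLt, Fin.eta, Fin.rev_rev]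

theorem eval_poly (x : Fin n → ℝ) :
    MvPolynomial.eval x (poly n c) = blossom (codegCoeff c) univ x := by
  have hblossom : blossom (codegCoeff c) univ x = ∑ k ∈ range (n + 1), codegCoeff c (n - k) *
      ∑ T ∈ powersetCard k univ, ∏ i ∈ T, x i := by
    rw [blossom, sum_powerset]
    simp only [card_univ, Fintype.card_fin, mul_sum]
    exact sum_congr rfl fun k _ => sum_congr rfl fun T hT => by rw [(mem_powersetCard.1 hT).2]
  have hself : powersetCard n (univ : Finset (Fin n)) = {univ} := by
    simpa using powersetCard_self (univ : Finset (Fin n))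
  rw [hblossom, sum_range_succ, sum_range (n := n)]
  simp only [codegCoeff_sub, hself, Nat.sub_self, codegCoeff_zero, sum_singleton, poly, map_sub,
    map_prod, map_sum, map_mul, MvPolynomial.eval_X, MvPolynomial.eval_C, MvPolynomial.esymm,
    neg_mul, sum_neg_distrib]
  ring

theorem posSet_poly : posSet (poly n c) = {x | 0 < blossom (codegCoeff c) univ x} := by
  simp only [posSet, eval_poly]

theorem diagRestriction_poly_eq_appell :
    diagRestriction (poly n c) = appell (codegCoeff c) n := by
  rw [diagRestriction_poly, appell, sum_range_succ, sum_range (n := n)]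
  simp only [codegCoeff_sub, Nat.choose_self, Nat.sub_self, codegCoeff_zero, mul_neg, map_neg,
    neg_mul, sum_neg_distrib, Nat.cast_one, mul_one, map_one, one_mul, mul_comm (c _)]
  ring

end Poly

end InverseSigma

theorem theorem1p2 (n : ℕ) (hn : 1 ≤ n) (c : Fin n → ℝ) :
    ((∃ G : Set (Fin n → ℝ), InverseSigma.IsConnComponent
          (InverseSigma.posSet (InverseSigma.poly n c)) G ∧ InverseSigma.UpsilonStable G) ↔
      InverseSigma.RightNoetherian (InverseSigma.diagRestriction (InverseSigma.poly n c))) ∧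
    (∀ G : Set (Fin n → ℝ), InverseSigma.IsConnComponent
          (InverseSigma.posSet (InverseSigma.poly n c)) G → InverseSigma.UpsilonStable G →
      (InverseSigma.StrictlyUpsilonStable G ↔
        InverseSigma.StrictlyRightNoetherian
          (InverseSigma.diagRestriction (InverseSigma.poly n c)))) := by
  obtain ⟨m, rfl⟩ : ∃ m, n = m + 1 := Nat.exists_eq_add_of_le' hn
  have hb : 0 < InverseSigma.codegCoeff c 0 := by simp
  rw [InverseSigma.posSet_poly, InverseSigma.diagRestriction_poly_eq_appell]
  exact ⟨InverseSigma.exists_isConnComponent_upsilonStable_iff hb,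
    fun G hG hst => hG.strictlyUpsilonStable_iff hst hb⟩
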